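/- Let $S\subset\mathbb{R}^2$ be a circle of positive radius, let $p,q\in S$ be diametrically opposite points, and let $U$ be any neighborhood of $\{p,q\}$. Then $E=S\setminus U$ can be moved continuously to any other position in the plane in arbitrarily small area. That is, for every orientation-preserving isometry $g$ of $\mathbb{R}^2$ and every $\varepsilon>0$ there is a continuous path $t\mapsto\gamma_t$, $t\in[0,1]$, of orientation-preserving isometries of $\mathbb{R}^2$ such that $\gamma_0=\mathrm{id}$, $\gamma_1=g$, and $$\Bigl|\bigcup_{t\in[0,1]}\gamma_t(E)\Bigr|<\varepsilon,$$ where $|\cdot|$ denotes Lebesgue (outer) measure on $\mathbb{R}^2$. -/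

import Mathlib

open scoped Topology

namespace KakeyaNeedle

/-- The Euclidean plane `ℝ²`. -/
abbrev Plane : Type := EuclideanSpace ℝ (Fin 2)

/-- `g` is an orientation-preserving isometry of the plane (an element of `SE(2)`). -/
def IsRigidMotion (g : Plane ≃ᵃⁱ[ℝ] Plane) : Prop :=
  0 < LinearMap.det (g.linearIsometryEquiv.toLinearEquiv : Plane →ₗ[ℝ] Plane)

/-- A continuous movement in the plane: a family of rigid motions, parametrized by the time
`t ∈ [0, 1]`, that is jointly continuous in the time and the point that is moved. For isometries
this is continuity of the path `t ↦ γ t` in the usual topology of `SE(2)`. -/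
structure IsMovement (γ : unitInterval → Plane ≃ᵃⁱ[ℝ] Plane) : Prop where
  rigid : ∀ t, IsRigidMotion (γ t)
  continuous : Continuous fun p : unitInterval × Plane => γ p.1 p.2

/-- The region covered by the set `E` in the course of the movement `γ`. -/
def sweptRegion (γ : unitInterval → Plane ≃ᵃⁱ[ℝ] Plane) (E : Set Plane) : Set Plane :=
  ⋃ t, γ t '' E

/-- The strong Kakeya property: `E` can be moved continuously in the plane to any other shifted
or rotated position `g(E)` within a set of arbitrarily small area. -/
def StrongKakeyaProperty (E : Set Plane) : Prop :=
  ∀ g : Plane ≃ᵃⁱ[ℝ] Plane, IsRigidMotion g → ∀ ε : ℝ, 0 < ε →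
    ∃ γ : unitInterval → Plane ≃ᵃⁱ[ℝ] Plane, IsMovement γ ∧
      γ 0 = AffineIsometryEquiv.refl ℝ Plane ∧ γ 1 = g ∧
      MeasureTheory.volume (sweptRegion γ E) < ENNReal.ofReal ε

end KakeyaNeedle

namespace KakeyaNeedle

open Set MeasureTheory

/-! An arc of angle `τ` translated in a direction within angle `α` of one of its tangents sweeps
area at most `r (τ + α) τ` per unit length. The circle is cut into short arcs, and a translation is
replaced by a fine zigzag in two directions, each leg again by a zigzag, and so on down a binary
tree of depth `k`.

Each arc is paid for at a node whose direction is nearly tangent to it. The true motion there is so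
close to the straight one that the thin ribbon bounds the area, whatever happens further down
(`Movable.exempt_less`). Below such a node the arc is exempt. The exempt tangent directions form an
interval growing by `α` per level (`movable_tangentArcs`). At the leaves only a short interval is
left, and a rotation about the centre, which sweeps a null set, turns the two gaps of `E` there
(`movable_of_nearly_all_exempt`).

Zigzags are longer than the segments they replace, but the loss telescopes (`weight_step`) and is
bounded independently of `k`. Hence the total area is `O(α)`. -/

/-- The unit complex number with argument `x`. -/
noncomputable def dir (x : ℝ) : ℂ := Complex.exp (x * Complex.I)

lemma dir_zero : dir 0 = 1 := by simp [dir]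

lemma dir_add (x y : ℝ) : dir (x + y) = dir x * dir y := by
  simp [dir, add_mul, Complex.exp_add]

lemma dir_re (x : ℝ) : (dir x).re = Real.cos x := Complex.exp_ofReal_mul_I_re x

lemma dir_im (x : ℝ) : (dir x).im = Real.sin x := Complex.exp_ofReal_mul_I_im x

lemma norm_dir (x : ℝ) : ‖dir x‖ = 1 := Complex.norm_exp_ofReal_mul_I x

lemma continuous_dir : Continuous dir := by unfold dir; fun_prop

lemma norm_dir_sub_dir_le (x y : ℝ) : ‖dir x - dir y‖ ≤ |x - y| := by
  have h : dir x - dir y = dir y * (Complex.exp (Complex.I * ((x - y : ℝ) : ℂ)) - 1) := by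
    rw [mul_sub, mul_one, mul_comm Complex.I]
    change _ = dir y * dir (x - y) - _
    rw [← dir_add]; ring_nf
  rw [h, norm_mul, norm_dir, one_mul]
  exact Real.norm_exp_I_mul_ofReal_sub_one_le

lemma dir_add_int_mul_pi (x : ℝ) (m : ℤ) :
    dir (x + m * Real.pi) = dir x ∨ dir (x + m * Real.pi) = -dir x := by
  rcases Int.even_or_odd m with hm | hm
  · left
    apply Complex.ext
    · rw [dir_re, dir_re, Real.cos_add_int_mul_pi, hm.neg_one_zpow, one_mul]
    · rw [dir_im, dir_im, Real.sin_add_int_mul_pi, hm.neg_one_zpow, one_mul]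
  · right
    apply Complex.ext
    · rw [Complex.neg_re, dir_re, dir_re, Real.cos_add_int_mul_pi, hm.neg_one_zpow, neg_one_mul]
    · rw [Complex.neg_im, dir_im, dir_im, Real.sin_add_int_mul_pi, hm.neg_one_zpow, neg_one_mul]

lemma exists_eq_mul_dir (r : ℝ) (w : ℂ) (hw : ‖w‖ = r) : ∃ x, w = r * dir x :=
  ⟨w.arg, by rw [← hw]; exact (Complex.norm_mul_exp_arg_mul_I w).symm⟩

/-! ### Area swept by a translated arc -/

/-- The union of the translates of the circular arc `r * dir θ`, `θ ∈ J`, along the segment of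
length `c` and direction `x`. -/
def ribbon (r x c : ℝ) (J : Set ℝ) : Set ℂ :=
  {y | ∃ t ∈ Icc 0 c, ∃ θ ∈ J, y = t * dir x + r * dir θ}

lemma isCompact_ribbon (r x c : ℝ) {J : Set ℝ} (hJ : IsCompact J) :
    IsCompact (ribbon r x c J) := by
  have : ribbon r x c J =
      (fun q : ℝ × ℝ => (q.1 * dir x + r * dir q.2 : ℂ)) '' (Icc 0 c ×ˢ J) := by
    ext y
    constructor
    · rintro ⟨t, ht, θ, hθ, rfl⟩
      exact ⟨(t, θ), ⟨ht, hθ⟩, rfl⟩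
    · rintro ⟨⟨t, θ⟩, ⟨ht, hθ⟩, rfl⟩
      exact ⟨t, ht, θ, hθ, rfl⟩
  rw [this]
  refine (isCompact_Icc.prod hJ).image ?_
  have := continuous_dir
  fun_prop

lemma hasFDerivAt_ribbon (r x : ℝ) (ζ : ℂ) :
    HasFDerivAt (fun ζ : ℂ => (ζ.re * dir x + r * dir ζ.im : ℂ))
      (Complex.reCLM.smulRight (dir x) +
        Complex.imCLM.smulRight (r * (dir ζ.im * Complex.I))) ζ := by
  have h1 : HasFDerivAt (fun ζ : ℂ => (ζ.re * dir x : ℂ)) (Complex.reCLM.smulRight (dir x)) ζ := by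
    have := Complex.reCLM.hasFDerivAt (x := ζ) |>.smul_const (dir x)
    simpa using this
  have h2 : HasDerivAt (fun t : ℝ => (r * dir t : ℂ)) (r * (dir ζ.im * Complex.I)) ζ.im := by
    have h3 : HasDerivAt (fun t : ℝ => ((t : ℂ) * Complex.I)) Complex.I ζ.im := by
      simpa using (Complex.ofRealCLM.hasDerivAt (x := ζ.im)).mul_const Complex.I
    exact (h3.cexp).const_mul (r : ℂ)
  refine h1.add ?_
  have h4 : Complex.imCLM.smulRight (r * (dir ζ.im * Complex.I)) =
      (ContinuousLinearMap.toSpanSingleton ℝ (r * (dir ζ.im * Complex.I) : ℂ)).comp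
        Complex.imCLM := ContinuousLinearMap.ext fun v => by simp
  rw [h4]
  exact h2.hasFDerivAt.comp ζ (Complex.imCLM.hasFDerivAt (x := ζ))

lemma det_ribbon (r x θ : ℝ) :
    (Complex.reCLM.smulRight (dir x) +
        Complex.imCLM.smulRight (r * (dir θ * Complex.I)) : ℂ →L[ℝ] ℂ).det
      = r * Real.cos (θ - x) := by
  rw [ContinuousLinearMap.det, ← LinearMap.det_toMatrix Complex.basisOneI, Matrix.det_fin_two]
  simp [LinearMap.toMatrix_apply, dir_re, dir_im, Real.cos_sub]
  ring

/-- Change of variables from `(t, θ)`: the Jacobian `r * cos (θ - x)` vanishes where the tangent is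
parallel to the motion. Only the inequality is needed, so overlaps do no harm. -/
lemma volume_ribbon_le {r : ℝ} (hr : 0 ≤ r) (x c κ a b : ℝ)
    (hκ : ∀ θ ∈ Icc a b, |Real.cos (θ - x)| ≤ κ) :
    volume (ribbon r x c (Icc a b)) ≤
      ENNReal.ofReal (r * κ) * (ENNReal.ofReal c * ENNReal.ofReal (b - a)) := by
  have himg : ribbon r x c (Icc a b) =
      (fun ζ : ℂ => (ζ.re * dir x + r * dir ζ.im : ℂ)) '' (Icc 0 c ×ℂ Icc a b) := by
    ext y
    constructor
    · rintro ⟨t, ht, θ, hθ, rfl⟩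
      exact ⟨⟨t, θ⟩, ⟨ht, hθ⟩, rfl⟩
    · rintro ⟨⟨t, θ⟩, ⟨ht, hθ⟩, rfl⟩
      exact ⟨t, ht, θ, hθ, rfl⟩
  have hmeas : MeasurableSet (Icc 0 c ×ℂ Icc a b) :=
    (Complex.measurable_re measurableSet_Icc).inter (Complex.measurable_im measurableSet_Icc)
  have hvol : volume (Icc 0 c ×ℂ Icc a b) = ENNReal.ofReal c * ENNReal.ofReal (b - a) := by
    have : (Icc 0 c ×ℂ Icc a b) =
        Complex.measurableEquivRealProd ⁻¹' (Icc 0 c ×ˢ Icc a b) := rfl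
    rw [this, Complex.volume_preserving_equiv_real_prod.measure_preimage_equiv,
      Measure.volume_eq_prod, Measure.prod_prod, Real.volume_Icc, Real.volume_Icc, sub_zero]
  rw [himg]
  refine (addHaar_image_le_lintegral_abs_det_fderiv volume hmeas
    fun ζ _ => (hasFDerivAt_ribbon r x ζ).hasFDerivWithinAt).trans ?_
  rw [← hvol, ← setLIntegral_const]
  refine setLIntegral_mono measurable_const fun ζ hζ => ENNReal.ofReal_le_ofReal ?_
  rw [det_ribbon, abs_mul, abs_of_nonneg hr]
  exact mul_le_mul_of_nonneg_left (hκ _ hζ.2) hr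

/-! ### Movements with exempt arcs -/

/-- The positions `(z, ψ)` (translation by `z` after the rotation by `ψ`) that carry `E` into
`A`. -/
def placements (E A : Set ℂ) : Set (ℂ × ℝ) := {q | ∀ w ∈ E, q.1 + dir q.2 * w ∈ A}

lemma placements_mono (E : Set ℂ) {A B : Set ℂ} (h : A ⊆ B) : placements E A ⊆ placements E B :=
  fun _ hq w hw => h (hq w hw)

lemma joinedIn_rotate {E A : Set ℂ} (z : ℂ) (ψ ψ' : ℝ) (h : ∀ s, ∀ w ∈ E, z + dir s * w ∈ A) :
    JoinedIn (placements E A) (z, ψ) (z, ψ') := by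
  apply JoinedIn.of_segment_subset
  rw [← Prod.image_mk_segment_right]
  rintro _ ⟨s, _, rfl⟩ w hw
  exact h s w hw

lemma joinedIn_translate {E A : Set ℂ} (z : ℂ) (x c ψ : ℝ) (hc : 0 ≤ c)
    (h : ∀ t ∈ Icc 0 c, ∀ w ∈ E, z + t * dir x + dir ψ * w ∈ A) :
    JoinedIn (placements E A) (z, ψ) (z + c * dir x, ψ) := by
  apply JoinedIn.of_segment_subset
  rw [← Prod.image_mk_segment_left]
  rintro _ ⟨s, hs, rfl⟩ w hw
  rw [segment_eq_image'] at hs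
  obtain ⟨u, hu, rfl⟩ := hs
  have := h (u * c) ⟨mul_nonneg hu.1 hc, mul_le_of_le_one_left hc hu.2⟩ w hw
  convert this using 2
  simp
  ring

/-- Every position `(z, ψ)` of `E` can be moved to one with centre `z + c * dir x`, so that the
swept region is covered by sets `A j`, where `A j` is close to the union of the translates of the
arc `r * dir θ`, `θ ∈ J j`, along the segment from `z` to `z + c * dir x`, and has area at most
`H * c` unless `j ∈ C`. -/
def Movable {ι : Type*} (E : Set ℂ) (r : ℝ) (J : ι → Set ℝ) (x : ℝ) (C : Set ι) (H c η : ℝ) :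
    Prop :=
  ∀ z ψ, ∃ (ψ' : ℝ) (A : ι → Set ℂ),
    JoinedIn (placements E (⋃ j, A j)) (z, ψ) (z + c * dir x, ψ') ∧
    (∀ j, ∀ y ∈ A j, ∃ t ∈ Icc 0 c, ∃ θ ∈ J j, ‖y - (z + t * dir x + r * dir θ)‖ ≤ η) ∧
    ∀ j, j ∈ C ∨ volume (A j) ≤ ENNReal.ofReal (H * c)

section

variable {ι : Type*} {E : Set ℂ} {r : ℝ} {J : ι → Set ℝ}

lemma Movable.add {x : ℝ} {C : Set ι} {H c c' η : ℝ} (hH : 0 ≤ H) (hc : 0 ≤ c) (hc' : 0 ≤ c')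
    (h : Movable E r J x C H c η) (h' : Movable E r J x C H c' η) :
    Movable E r J x C H (c + c') η := by
  intro z ψ
  obtain ⟨ψ₁, A, h1, h2, h3⟩ := h z ψ
  obtain ⟨ψ₂, B, k1, k2, k3⟩ := h' (z + c * dir x) ψ₁
  refine ⟨ψ₂, fun j => A j ∪ B j, ?_, ?_, fun j => ?_⟩
  · have e : z + ((c + c' : ℝ) : ℂ) * dir x = z + c * dir x + c' * dir x := by
      push_cast; ring
    rw [e]
    exact (h1.mono (placements_mono E (iUnion_mono fun j => subset_union_left))).trans
      (k1.mono (placements_mono E (iUnion_mono fun j => subset_union_right)))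
  · rintro j y (hy | hy)
    · obtain ⟨t, ht, θ, hθ, hd⟩ := h2 j y hy
      exact ⟨t, ⟨ht.1, by linarith [ht.2]⟩, θ, hθ, hd⟩
    · obtain ⟨t, ht, θ, hθ, hd⟩ := k2 j y hy
      refine ⟨c + t, ⟨by linarith [ht.1], by linarith [ht.2]⟩, θ, hθ, ?_⟩
      convert hd using 3
      push_cast; ring
  · rcases h3 j with h | h
    · exact Or.inl h
    rcases k3 j with k | k
    · exact Or.inl k
    right
    refine (measure_union_le _ _).trans ((add_le_add h k).trans_eq ?_)
    rw [← ENNReal.ofReal_add (by positivity) (by positivity), mul_add]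

lemma Movable.nat_mul {x : ℝ} {C : Set ι} {H c η : ℝ} (hH : 0 ≤ H) (hc : 0 ≤ c)
    (h : Movable E r J x C H c η) (n : ℕ) :
    Movable E r J x C H ((n + 1) * c) η := by
  induction n with
  | zero => simpa using h
  | succ n ih =>
    have e : ((n + 1 : ℕ) + 1 : ℝ) * c = (n + 1) * c + c := by push_cast; ring
    rw [e]
    exact ih.add hH (by positivity) hc h

lemma exists_thickening_volume_lt {K : Set ℂ} (hK : IsCompact K) {v : ENNReal}
    (hv : volume K < v) : ∃ δ > 0, volume (Metric.cthickening δ K) < v := by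
  have h := (tendsto_measure_cthickening_of_isCompact (μ := volume) hK).eventually
    (gt_mem_nhds hv)
  obtain ⟨δ, hδ, hb⟩ := Metric.eventually_nhds_iff.1 h
  exact ⟨δ / 2, half_pos hδ, hb (by simp [abs_of_pos hδ, hδ])⟩

/-- Arcs that are nearly tangent to the direction of the movement need not be exempted. -/
lemma Movable.exempt_less [Finite ι] {x : ℝ} {C C' : Set ι} {H : ℝ}
    (hJ : ∀ j, IsCompact (J j))
    (h : ∀ c > 0, ∀ η > 0, Movable E r J x C' H c η)
    (hC : ∀ j ∈ C', j ∉ C → ∀ c > 0, volume (ribbon r x c (J j)) < ENNReal.ofReal (H * c))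
    (c : ℝ) (hc : 0 < c) (η : ℝ) (hη : 0 < η) : Movable E r J x C H c η := by
  have hex : ∀ j, ∃ δ > 0, j ∈ C' → j ∉ C →
      volume (Metric.cthickening δ (ribbon r x c (J j))) < ENNReal.ofReal (H * c) := by
    intro j
    by_cases hj : j ∈ C' ∧ j ∉ C
    · obtain ⟨δ, hδ, hb⟩ := exists_thickening_volume_lt (isCompact_ribbon r x c (hJ j))
        (hC j hj.1 hj.2 c hc)
      exact ⟨δ, hδ, fun _ _ => hb⟩
    · exact ⟨1, one_pos, fun h1 h2 => (hj ⟨h1, h2⟩).elim⟩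
  choose δ hδ hb using hex
  obtain ⟨δ₀, hδ₀, hle⟩ : ∃ δ₀ > 0, ∀ j, δ₀ ≤ δ j := by
    rcases isEmpty_or_nonempty ι with hι | hι
    · exact ⟨1, one_pos, fun j => hι.elim j⟩
    · obtain ⟨j₀, hj₀⟩ := Finite.exists_min δ
      exact ⟨δ j₀, hδ j₀, hj₀⟩
  intro z ψ
  obtain ⟨ψ', A, h1, h2, h3⟩ := h c hc (min η δ₀) (lt_min hη hδ₀) z ψ
  refine ⟨ψ', A, h1, fun j y hy => ?_, fun j => ?_⟩
  · obtain ⟨t, ht, θ, hθ, hd⟩ := h2 j y hy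
    exact ⟨t, ht, θ, hθ, hd.trans (min_le_left _ _)⟩
  · by_cases hj : j ∈ C
    · exact Or.inl hj
    right
    by_cases hj' : j ∈ C'
    · refine le_trans ?_ (hb j hj' hj).le
      rw [← measure_preimage_add volume (-z) (Metric.cthickening _ _)]
      refine measure_mono fun y hy => ?_
      obtain ⟨t, ht, θ, hθ, hd⟩ := h2 j y hy
      refine Metric.mem_cthickening_of_dist_le _ (t * dir x + r * dir θ) _ _
        ⟨t, ht, θ, hθ, rfl⟩ ?_
      rw [dist_eq_norm]
      refine le_trans (le_of_eq ?_) (hd.trans ((min_le_right _ _).trans (hle j)))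
      congr 1
      ring
    · exact (h3 j).resolve_left hj'

/-- A movement in the direction `x` is a fine zigzag of movements in two other directions. -/
lemma Movable.zigzag {x x₁ x₂ p q : ℝ} {C : Set ι} {H H₁ H₂ : ℝ}
    (hH : 0 ≤ H) (hH₁ : 0 ≤ H₁) (hH₂ : 0 ≤ H₂) (hp : 0 < p) (hq : 0 < q)
    (hdir : dir x = p * dir x₁ + q * dir x₂) (hle : p * H₁ + q * H₂ ≤ H)
    (h₁ : ∀ c > 0, ∀ η > 0, Movable E r J x₁ C H₁ c η)
    (h₂ : ∀ c > 0, ∀ η > 0, Movable E r J x₂ C H₂ c η)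
    (c : ℝ) (hc : 0 < c) (η : ℝ) (hη : 0 < η) : Movable E r J x C H c η := by
  obtain ⟨n, hn⟩ := exists_nat_gt (c * (p + q) / (η / 2))
  have hn0 : (0 : ℝ) < n + 1 := by positivity
  obtain ⟨d, hd⟩ : ∃ d, d = c / (n + 1) := ⟨_, rfl⟩
  have hd0 : 0 < d := by rw [hd]; positivity
  have hcd : c = (n + 1) * d := by rw [hd]; field_simp
  have hsmall : d * (p + q) ≤ η / 2 := by
    rw [div_lt_iff₀ (by positivity)] at hn
    rw [hd, div_mul_eq_mul_div, div_le_iff₀ hn0]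
    nlinarith
  rw [hcd]
  refine Movable.nat_mul hH hd0.le ?_ n
  intro z ψ
  obtain ⟨ψ₁, A, a1, a2, a3⟩ := h₁ (p * d) (by positivity) (η / 2) (by positivity) z ψ
  obtain ⟨ψ₂, B, b1, b2, b3⟩ := h₂ (q * d) (by positivity) (η / 2) (by positivity)
    (z + (p * d : ℝ) * dir x₁) ψ₁
  have key : ∀ (t y : ℝ), 0 ≤ t → ‖(t : ℂ) * dir y‖ = t := fun t y ht => by
    rw [norm_mul, norm_dir, mul_one, Complex.norm_real, Real.norm_of_nonneg ht]
  refine ⟨ψ₂, fun j => A j ∪ B j, ?_, ?_, fun j => ?_⟩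
  · have e : z + (d : ℂ) * dir x = z + (p * d : ℝ) * dir x₁ + (q * d : ℝ) * dir x₂ := by
      rw [hdir]; push_cast; ring
    rw [e]
    exact (a1.mono (placements_mono E (iUnion_mono fun j => subset_union_left))).trans
      (b1.mono (placements_mono E (iUnion_mono fun j => subset_union_right)))
  · rintro j y (hy | hy)
    · obtain ⟨t, ht, θ, hθ, hb⟩ := a2 j y hy
      -- The two legs have total length at most `η / 2`, so comparison with the arc at the start of
      -- the step suffices.
      refine ⟨0, ⟨le_rfl, hd0.le⟩, θ, hθ, ?_⟩
      have e : y - (z + (0 : ℝ) * dir x + r * dir θ) =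
          (y - (z + t * dir x₁ + r * dir θ)) + t * dir x₁ := by push_cast; ring
      rw [e]
      refine (norm_add_le _ _).trans ?_
      rw [key t _ ht.1]
      nlinarith [ht.2, mul_pos hq hd0]
    · obtain ⟨t, ht, θ, hθ, hb⟩ := b2 j y hy
      refine ⟨0, ⟨le_rfl, hd0.le⟩, θ, hθ, ?_⟩
      have e : y - (z + (0 : ℝ) * dir x + r * dir θ) =
          (y - (z + (p * d : ℝ) * dir x₁ + t * dir x₂ + r * dir θ)) +
            ((p * d : ℝ) * dir x₁ + t * dir x₂) := by push_cast; ring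
      rw [e]
      refine (norm_add_le _ _).trans ?_
      have := norm_add_le ((p * d : ℝ) * dir x₁ : ℂ) (t * dir x₂)
      rw [key t _ ht.1, key (p * d) _ (by positivity)] at this
      nlinarith [ht.2]
  · rcases a3 j with h | h
    · exact Or.inl h
    rcases b3 j with k | k
    · exact Or.inl k
    right
    refine (measure_union_le _ _).trans ((add_le_add h k).trans ?_)
    rw [← ENNReal.ofReal_add (by positivity) (by positivity)]
    refine ENNReal.ofReal_le_ofReal ?_
    nlinarith

end

/-! ### Tangent directions and the leaves of the tree -/

/-- The arcs that contain a point at which the tangent has one of the directions `x - s * ρ`,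
`0 ≤ ρ ≤ R`. -/
def tangentArcs {ι : Type*} (J : ι → Set ℝ) (x s R : ℝ) : Set ι :=
  {j | ∃ θ ∈ J j, ∃ ρ ∈ Icc 0 R, Real.cos (θ - (x - s * ρ)) = 0}

/-- Modulo `π`, the non-exempt directions form an interval of length `π - R`; the estimate is the
distance to its midpoint. -/
lemma exists_near_of_cos_ne_zero {x s R θ : ℝ} (hs : s = 1 ∨ s = -1)
    (h : ∀ ρ ∈ Icc 0 R, Real.cos (θ - (x - s * ρ)) ≠ 0) :
    ∃ m : ℤ, |θ - (x + s * ((Real.pi - R) / 2) + Real.pi / 2 + m * Real.pi)| ≤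
      (Real.pi - R) / 2 := by
  obtain ⟨u, hu⟩ : ∃ u, u = toIcoMod Real.pi_pos 0 (s * (θ - Real.pi / 2 - x)) := ⟨_, rfl⟩
  obtain ⟨m, hm⟩ : ∃ m, m = toIcoDiv Real.pi_pos 0 (s * (θ - Real.pi / 2 - x)) := ⟨_, rfl⟩
  have hmem := toIcoMod_mem_Ico Real.pi_pos 0 (s * (θ - Real.pi / 2 - x))
  have hsum := toIcoMod_add_toIcoDiv_zsmul Real.pi_pos 0 (s * (θ - Real.pi / 2 - x))
  rw [← hu, zero_add] at hmem
  rw [← hu, ← hm, zsmul_eq_mul] at hsum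
  have hlt : u < Real.pi - R := by
    by_contra! hge
    refine h (Real.pi - u) ⟨by linarith [hmem.2], by linarith⟩ ?_
    rw [Real.cos_eq_zero_iff]
    rcases hs with rfl | rfl
    · exact ⟨m + 1, by push_cast; linarith⟩
    · exact ⟨-(m + 1), by push_cast; linarith⟩
  rcases hs with rfl | rfl
  · refine ⟨m, ?_⟩
    rw [abs_le]
    constructor <;> linarith [hmem.1]
  · refine ⟨-m, ?_⟩
    rw [abs_le]
    push_cast
    constructor <;> linarith [hmem.1]

section

variable {ι : Type*} {E : Set ℂ} {r : ℝ} {J : ι → Set ℝ}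

/-- If almost all tangent directions are exempt, then after a rotation `E` can be translated. -/
lemma movable_of_nearly_all_exempt {w₀ : ℂ} {ρ : ℝ} (hr : 0 < r) (hw₀ : ‖w₀‖ = r)
    (hE : ∀ w ∈ E, ‖w‖ = r ∧ ρ ≤ ‖w - w₀‖ ∧ ρ ≤ ‖w + w₀‖)
    (hcover : ∀ θ : ℝ, ∃ j, ∃ θ' ∈ J j, dir θ' = dir θ)
    {x s R H c η : ℝ} (hs : s = 1 ∨ s = -1) (hR : r * ((Real.pi - R) / 2) < ρ)
    (hc : 0 ≤ c) (hη : 0 ≤ η) :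
    Movable E r J x (tangentArcs J x s R) H c η := by
  intro z ψ
  obtain ⟨τ, hτ⟩ := exists_eq_mul_dir r w₀ hw₀
  obtain ⟨φ, hφ⟩ : ∃ φ, φ = x + s * ((Real.pi - R) / 2) + Real.pi / 2 := ⟨_, rfl⟩
  have harc : ∀ a, ∀ w ∈ E, ∃ j, ∃ θ ∈ J j, dir a * w = r * dir θ := by
    intro a w hw
    obtain ⟨y, hy⟩ := exists_eq_mul_dir r w (hE w hw).1
    obtain ⟨j, θ, hθ, he⟩ := hcover (a + y)
    exact ⟨j, θ, hθ, by rw [he, dir_add, hy]; ring⟩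
  have hexempt : ∀ w ∈ E, ∀ j, ∀ θ ∈ J j, dir (φ - τ) * w = r * dir θ →
      j ∈ tangentArcs J x s R := by
    intro w hw j θ hθ he
    by_contra hj
    obtain ⟨m, hm⟩ := exists_near_of_cos_ne_zero (x := x) (R := R) (θ := θ) hs
      fun ρ' hρ' h0 => hj ⟨θ, hθ, ρ', hρ', h0⟩
    rw [← hφ] at hm
    have hd := (norm_dir_sub_dir_le _ _).trans hm
    have hφ₀ : dir (φ - τ) * w₀ = r * dir φ := by
      rw [hτ, ← mul_assoc, mul_comm _ (r : ℂ), mul_assoc, ← dir_add, sub_add_cancel]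
    have hscale : ∀ v : ℂ, ‖v‖ = ‖dir (φ - τ) * v‖ := fun v => by
      rw [norm_mul, norm_dir, one_mul]
    have hrr : ∀ v : ℂ, ‖(r : ℂ) * v‖ = r * ‖v‖ := fun v => by
      rw [norm_mul, Complex.norm_real, Real.norm_of_nonneg hr.le]
    have hb := (mul_le_mul_of_nonneg_left hd hr.le).trans_lt hR
    rcases dir_add_int_mul_pi φ m with h | h
    · refine absurd (hE w hw).2.1 (not_le.2 ?_)
      rwa [hscale, mul_sub, he, hφ₀, ← mul_sub, hrr, ← h]
    · refine absurd (hE w hw).2.2 (not_le.2 ?_)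
      rwa [hscale, mul_add, he, hφ₀, ← mul_add, hrr, ← sub_neg_eq_add, ← h]
  -- The angle `φ - τ` puts `w₀` in the middle of the non-exempt directions. A non-exempt arc is
  -- then empty of points of `E` during the translation, so it needs only `t = 0`, inside the null
  -- circle of the rotation.
  refine ⟨φ - τ, fun j => {y | ∃ t ∈ Icc 0 c, ∃ θ ∈ J j, y = z + t * dir x + r * dir θ ∧
    (j ∈ tangentArcs J x s R ∨ t = 0)}, ?_, ?_, fun j => ?_⟩
  · refine (joinedIn_rotate z ψ (φ - τ) fun a w hw => ?_).trans
      (joinedIn_translate z x c (φ - τ) hc fun t ht w hw => ?_)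
    · obtain ⟨j, θ, hθ, he⟩ := harc a w hw
      exact mem_iUnion.2 ⟨j, 0, ⟨le_rfl, hc⟩, θ, hθ, by simp [he], Or.inr rfl⟩
    · obtain ⟨j, θ, hθ, he⟩ := harc (φ - τ) w hw
      exact mem_iUnion.2 ⟨j, t, ht, θ, hθ, by rw [he], Or.inl (hexempt w hw j θ hθ he)⟩
  · rintro j y ⟨t, ht, θ, hθ, rfl, -⟩
    exact ⟨t, ht, θ, hθ, by simpa using hη⟩
  · by_cases hj : j ∈ tangentArcs J x s R
    · exact Or.inl hj
    right
    refine le_trans (measure_mono ?_) ((Measure.addHaar_sphere volume z r).le.trans zero_le)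
    rintro y ⟨t, ht, θ, hθ, rfl, h | rfl⟩
    · exact absurd h hj
    · simp [norm_dir, abs_of_pos hr]

/-- The cosine is 1-Lipschitz and vanishes within `τ + α` of every relevant angle, so the ribbon is
thin. -/
lemma Movable.exempt_less_of_near [Finite ι] {a : ι → ℝ} {τ α x H : ℝ} {C C' : Set ι}
    (hr : 0 ≤ r) (hτ : 0 ≤ τ) (hJ : ∀ j, J j = Icc (a j) (a j + τ))
    (hH : r * (τ + α) * τ < H)
    (hC : ∀ j ∈ C', j ∉ C → ∃ θ ∈ J j, ∃ ρ, |ρ| ≤ α ∧ Real.cos (θ - (x + ρ)) = 0)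
    (h : ∀ c > 0, ∀ η > 0, Movable E r J x C' H c η)
    (c : ℝ) (hc : 0 < c) (η : ℝ) (hη : 0 < η) : Movable E r J x C H c η := by
  refine Movable.exempt_less (fun j => hJ j ▸ isCompact_Icc) h (fun j hj hj' c hc => ?_) c hc η hη
  obtain ⟨θ, hθ, ρ, hρ, h0⟩ := hC j hj hj'
  rw [hJ] at hθ ⊢
  have hκ : ∀ θ' ∈ Icc (a j) (a j + τ), |Real.cos (θ' - x)| ≤ τ + α := by
    intro θ' hθ'
    have h1 := Real.abs_cos_sub_cos_le (θ' - x) (θ - (x + ρ))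
    rw [h0, sub_zero] at h1
    refine h1.trans ?_
    have h2 : |θ' - θ| ≤ τ := abs_le.2 ⟨by linarith [hθ.2, hθ'.1], by linarith [hθ.1, hθ'.2]⟩
    have h3 := abs_add_le (θ' - θ) ρ
    have e : (θ' - x) - (θ - (x + ρ)) = θ' - θ + ρ := by ring
    rw [e]
    linarith
  have hα : 0 ≤ α := (abs_nonneg ρ).trans hρ
  refine (volume_ribbon_le hr x c (τ + α) _ _ hκ).trans_lt ?_
  rw [← ENNReal.ofReal_mul hc.le, ← ENNReal.ofReal_mul (by positivity), add_sub_cancel_left]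
  have hH0 : 0 < H := lt_of_le_of_lt (by positivity) hH
  rw [ENNReal.ofReal_lt_ofReal_iff (by positivity)]
  calc r * (τ + α) * (c * τ) = r * (τ + α) * τ * c := by ring
    _ < H * c := mul_lt_mul_of_pos_right hH hc

end

/-! ### Splitting directions -/

/-- The weight of a movement whose exempt directions form an interval of length `i * α`. -/
noncomputable def weight (α : ℝ) (i : ℕ) : ℝ := Real.cos (i * α / 2) * Real.cos ((i + 1) * α / 2)

/-- The two coefficients, those of `dir_split`, add up to `cos (i α / 2) / cos ((i + 2) α / 2)`,
which is the ratio of consecutive weights. -/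
lemma weight_step {α : ℝ} {i : ℕ} (hα : 0 < α) (hi : (i + 2) * α < Real.pi) :
    Real.sin (i * α + α) / Real.sin (i * α + 2 * α) * weight α (i + 1) +
      Real.sin α / Real.sin (i * α + 2 * α) * weight α (i + 1) = weight α i := by
  have hs : Real.sin (i * α + 2 * α) = 2 * Real.sin (i * α / 2 + α) * Real.cos (i * α / 2 + α) := by
    rw [← Real.sin_two_mul]; ring_nf
  have hadd : Real.sin (i * α + α) + Real.sin α =
      2 * Real.sin (i * α / 2 + α) * Real.cos (i * α / 2) := by
    rw [Real.sin_add_sin]; ring_nf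
  have h0 : 0 ≤ i * α / 2 := by positivity
  have h1 : 0 < Real.sin (i * α / 2 + α) :=
    Real.sin_pos_of_pos_of_lt_pi (by linarith) (by linarith [Real.pi_pos])
  have h2 : 0 < Real.cos (i * α / 2 + α) :=
    Real.cos_pos_of_mem_Ioo ⟨by linarith [Real.pi_pos], by linarith⟩
  rw [← add_mul, ← add_div, hadd, hs]
  have e1 : ((i + 1 : ℕ) : ℝ) * α / 2 = (i + 1) * α / 2 := by push_cast; ring
  have e2 : (((i + 1 : ℕ) : ℝ) + 1) * α / 2 = i * α / 2 + α := by push_cast; ring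
  rw [weight, weight, e1, e2]
  generalize Real.sin (i * α / 2 + α) = S at *
  generalize Real.cos (i * α / 2 + α) = K at *
  field_simp

/-- Law of sines: the two new directions lie at angles `α` and `R + α` on opposite sides of `x`,
just beyond the ends of the exempt interval. -/
lemma dir_split {x s R α : ℝ} (hs : s = 1 ∨ s = -1) (h : 0 < Real.sin (R + 2 * α)) :
    dir x = (Real.sin (R + α) / Real.sin (R + 2 * α) : ℝ) * dir (x + s * α) +
      (Real.sin α / Real.sin (R + 2 * α) : ℝ) * dir (x - s * (R + α)) := by
  have e : R + 2 * α = (R + α) + α := by ring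
  have e' : Real.sin (R + 2 * α) =
      Real.sin (R + α) * Real.cos α + Real.cos (R + α) * Real.sin α := by rw [e, Real.sin_add]
  clear e
  generalize Real.sin (R + 2 * α) = D at *
  have key : (1 : ℂ) = (Real.sin (R + α) / D : ℝ) * dir (s * α) +
      (Real.sin α / D : ℝ) * dir (-(s * (R + α))) := by
    apply Complex.ext
    · rw [Complex.add_re, Complex.re_ofReal_mul, Complex.re_ofReal_mul, dir_re, dir_re,
        Complex.one_re, Real.cos_neg]
      rcases hs with rfl | rfl
      · rw [one_mul, one_mul]
        field_simp
        linarith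
      · rw [neg_one_mul, neg_one_mul, Real.cos_neg, Real.cos_neg]
        field_simp
        linarith
    · rw [Complex.add_im, Complex.im_ofReal_mul, Complex.im_ofReal_mul, dir_im, dir_im,
        Complex.one_im, Real.sin_neg]
      rcases hs with rfl | rfl
      · rw [one_mul, one_mul]
        field_simp
        ring
      · rw [neg_one_mul, neg_one_mul, Real.sin_neg, Real.sin_neg]
        field_simp
        ring
  rw [sub_eq_add_neg, dir_add x, dir_add x]
  linear_combination (dir x) * key

/-- Splitting the directions of the movement until nearly all tangent directions are exempt. -/
lemma movable_tangentArcs {ι : Type*} [Finite ι] {E : Set ℂ} {r : ℝ} {J : ι → Set ℝ}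
    {w₀ : ℂ} {ρ : ℝ} (hr : 0 < r) (hw₀ : ‖w₀‖ = r)
    (hE : ∀ w ∈ E, ‖w‖ = r ∧ ρ ≤ ‖w - w₀‖ ∧ ρ ≤ ‖w + w₀‖)
    (hcover : ∀ θ : ℝ, ∃ j, ∃ θ' ∈ J j, dir θ' = dir θ)
    {a : ι → ℝ} {τ α β : ℝ} (hτ : 0 ≤ τ) (hJ : ∀ j, J j = Icc (a j) (a j + τ))
    {k : ℕ} (hα : 0 < α) (hk : (k + 1) * α < Real.pi) (hR : r * ((Real.pi - k * α) / 2) < ρ)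
    (hβ : ∀ i ≤ k, r * (τ + α) * τ < β * weight α i) (m : ℕ) :
    ∀ i, i + m = k → ∀ x s, s = 1 ∨ s = -1 → ∀ c > 0, ∀ η > 0,
      Movable E r J x (tangentArcs J x s (i * α)) (β * weight α i) c η := by
  induction m with
  | zero =>
    rintro i rfl x s hs c hc η hη
    exact movable_of_nearly_all_exempt hr hw₀ hE hcover hs hR hc.le hη.le
  | succ m ih =>
    intro i hi x s hs
    have hik : ((i : ℝ) + 1) ≤ k := by exact_mod_cast (by omega : i + 1 ≤ k)
    have hi2 : ((i : ℝ) + 2) * α < Real.pi :=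
      lt_of_le_of_lt (mul_le_mul_of_nonneg_right (by linarith) hα.le) hk
    have hi0 : 0 ≤ (i : ℝ) * α := by positivity
    have hsin : 0 < Real.sin (i * α + 2 * α) :=
      Real.sin_pos_of_pos_of_lt_pi (by linarith) (by linarith)
    have hsin₁ : 0 < Real.sin (i * α + α) :=
      Real.sin_pos_of_pos_of_lt_pi (by linarith) (by linarith)
    have hsin₂ : 0 < Real.sin α := Real.sin_pos_of_pos_of_lt_pi hα (by linarith)
    have hpos : ∀ j ≤ k, 0 ≤ β * weight α j := fun j hj =>
      le_trans (by positivity) (hβ j hj).le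
    have hcast : ((i + 1 : ℕ) : ℝ) * α = i * α + α := by push_cast; ring
    have hs' : ∀ t, |s * t| = |t| := fun t => by rcases hs with rfl | rfl <;> simp
    refine Movable.zigzag (x₁ := x + s * α) (x₂ := x - s * (i * α + α)) (hpos i (by omega))
      (hpos (i + 1) (by omega)) (hpos (i + 1) (by omega)) (div_pos hsin₁ hsin)
      (div_pos hsin₂ hsin) (dir_split hs hsin) ?_ ?_ ?_
    · rw [← weight_step hα hi2]
      apply le_of_eq; ring
    -- The enlarged interval starts at `x + s α` and ends where the old one does; the surplus is
    -- within `α` of the new direction.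
    · refine Movable.exempt_less_of_near (α := α) hr.le hτ hJ (hβ (i + 1) (by omega)) ?_
        (ih (i + 1) (by omega) _ s hs)
      rintro j ⟨θ, hθ, ρ', hρ', h0⟩ hj
      refine ⟨θ, hθ, -(s * ρ'), ?_, by rwa [← sub_eq_add_neg]⟩
      rw [abs_neg, hs', abs_of_nonneg hρ'.1]
      by_contra! hlt
      rw [hcast] at hρ'
      refine hj ⟨θ, hθ, ρ' - α, ⟨by linarith, by linarith [hρ'.2]⟩, ?_⟩
      rw [← h0]; congr 1; ring
    -- Here the new direction is at the other end, so the interval runs back towards `x` and the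
    -- side flips to `-s`.
    · refine Movable.exempt_less_of_near (α := α) hr.le hτ hJ (hβ (i + 1) (by omega)) ?_
        (ih (i + 1) (by omega) _ (-s) (by rcases hs with rfl | rfl <;> simp))
      rintro j ⟨θ, hθ, ρ', hρ', h0⟩ hj
      refine ⟨θ, hθ, s * ρ', ?_, by rw [← h0]; congr 1; ring⟩
      rw [hs', abs_of_nonneg hρ'.1]
      by_contra! hlt
      rw [hcast] at hρ'
      refine hj ⟨θ, hθ, i * α + α - ρ', ⟨by linarith [hρ'.2], by linarith⟩, ?_⟩
      rw [← h0]; congr 1; ring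

/-! ### Choice of parameters -/

lemma exists_arc_mem {N : ℕ} (hN : 0 < N) (θ : ℝ) :
    ∃ j : Fin N, ∃ θ' ∈ Icc (j * (2 * Real.pi / N)) (j * (2 * Real.pi / N) + 2 * Real.pi / N),
      dir θ' = dir θ := by
  have hN' : (0 : ℝ) < N := by exact_mod_cast hN
  have hτ : 0 < 2 * Real.pi / N := by have := Real.pi_pos; positivity
  obtain ⟨u, hu⟩ : ∃ u, u = toIcoMod Real.two_pi_pos 0 θ := ⟨_, rfl⟩
  have hmem := toIcoMod_mem_Ico Real.two_pi_pos 0 θ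
  have hsum := toIcoMod_add_toIcoDiv_zsmul Real.two_pi_pos 0 θ
  rw [← hu, zero_add] at hmem
  rw [← hu, zsmul_eq_mul] at hsum
  have h0 : 0 ≤ u / (2 * Real.pi / N) := div_nonneg hmem.1 hτ.le
  have h1 := Nat.floor_le h0
  have h2 := Nat.lt_floor_add_one (u / (2 * Real.pi / N))
  rw [le_div_iff₀ hτ] at h1
  rw [div_lt_iff₀ hτ] at h2
  have hlt : ⌊u / (2 * Real.pi / N)⌋₊ < N := by
    rw [Nat.floor_lt h0, div_lt_iff₀ hτ]
    calc u < 2 * Real.pi := hmem.2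
      _ = N * (2 * Real.pi / N) := by field_simp
  refine ⟨⟨_, hlt⟩, u, ⟨h1, by linarith⟩, ?_⟩
  rw [← hsum]
  apply Complex.ext
  · rw [dir_re, dir_re, Real.cos_add_int_mul_two_pi]
  · rw [dir_im, dir_im, Real.sin_add_int_mul_two_pi]

/-- A subset of a circle that avoids neighbourhoods of two antipodal points can be moved to any
position in small area. -/
lemma exists_joinedIn_placements {E : Set ℂ} {r ρ : ℝ} {w₀ : ℂ} (hr : 0 < r) (hρ : 0 < ρ)
    (hw₀ : ‖w₀‖ = r) (hE : ∀ w ∈ E, ‖w‖ = r ∧ ρ ≤ ‖w - w₀‖ ∧ ρ ≤ ‖w + w₀‖)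
    (z : ℂ) (ψ : ℝ) {ε : ℝ} (hε : 0 < ε) :
    ∃ A : Set ℂ, volume A < ENNReal.ofReal ε ∧
      JoinedIn (placements E A) (0, 0) (z, ψ) := by
  have hsph : ∀ (z : ℂ) (s : ℝ), ∀ w ∈ E, z + dir s * w ∈ Metric.sphere z r := by
    intro z s w hw
    simp [norm_dir, (hE w hw).1]
  have hnull : ∀ z : ℂ, volume (Metric.sphere z r) = 0 := fun z =>
    Measure.addHaar_sphere volume z r
  have hpi := Real.pi_pos
  have hpi3 := Real.pi_gt_three
  rcases eq_or_ne z 0 with rfl | hz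
  · refine ⟨Metric.sphere 0 r, by rw [hnull]; exact ENNReal.ofReal_pos.2 hε, ?_⟩
    exact joinedIn_rotate 0 0 ψ (hsph 0)
  obtain ⟨x, hx⟩ := exists_eq_mul_dir ‖z‖ z rfl
  obtain ⟨c, hc⟩ : ∃ c, c = ‖z‖ := ⟨_, rfl⟩
  have hc0 : 0 < c := hc ▸ norm_pos_iff.2 hz
  rw [← hc] at hx
  obtain ⟨δ, hδ, hδ1, hδρ⟩ : ∃ δ > 0, δ ≤ 1 ∧ r * (δ / 2) < ρ := by
    refine ⟨min 1 (ρ / r), lt_min one_pos (div_pos hρ hr), min_le_left _ _, ?_⟩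
    have h := min_le_right 1 (ρ / r)
    rw [le_div_iff₀ hr] at h
    linarith
  obtain ⟨κ, hκ⟩ : ∃ κ, κ = Real.cos ((Real.pi - δ / 2) / 2) := ⟨_, rfl⟩
  have hκ0 : 0 < κ := hκ ▸ Real.cos_pos_of_mem_Ioo ⟨by linarith, by linarith⟩
  -- With `k * α = π - δ` the leaves leave an interval of half-width `δ / 2`, which fits in the
  -- gaps. The bound `α < δ / 2` keeps all cosines in the weights at least `κ`, which does not
  -- depend on `k`; the other bound yields area below `ε`.
  obtain ⟨k, hk⟩ := exists_nat_gt
    (Real.pi / min (δ / 2) (ε * κ ^ 2 / (4 * Real.pi * r * c + 1)))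
  have hmin : 0 < min (δ / 2) (ε * κ ^ 2 / (4 * Real.pi * r * c + 1)) :=
    lt_min (by positivity) (by positivity)
  have hk0 : (0 : ℝ) < k := lt_trans (by positivity) hk
  obtain ⟨α, hα⟩ : ∃ α, α = (Real.pi - δ) / k := ⟨_, rfl⟩
  have hkα : k * α = Real.pi - δ := by rw [hα]; field_simp
  have hα0 : 0 < α := hα ▸ div_pos (by linarith) hk0
  have hαmin : α < min (δ / 2) (ε * κ ^ 2 / (4 * Real.pi * r * c + 1)) := by
    rw [div_lt_iff₀ hmin] at hk
    rw [hα, div_lt_iff₀ hk0]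
    linarith
  have hαδ := hαmin.trans_le (min_le_left _ _)
  have hαε := hαmin.trans_le (min_le_right _ _)
  rw [lt_div_iff₀ (by positivity)] at hαε
  obtain ⟨N, hN⟩ := exists_nat_gt (2 * Real.pi / α)
  have hN0 : (0 : ℝ) < N := lt_trans (by positivity) hN
  obtain ⟨τ, hτ⟩ : ∃ τ, τ = 2 * Real.pi / N := ⟨_, rfl⟩
  have hτ0 : 0 < τ := by rw [hτ]; positivity
  have hτα : τ < α := by
    rw [div_lt_iff₀ hα0] at hN
    rw [hτ, div_lt_iff₀ hN0]
    linarith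
  have hNτ : N * τ = 2 * Real.pi := by rw [hτ]; field_simp
  -- Since `τ < α` and every weight is at least `κ ^ 2`, this pays for a ribbon at each level.
  obtain ⟨β, hβ⟩ : ∃ β, β = r * (2 * α) * τ / κ ^ 2 := ⟨_, rfl⟩
  have hβ0 : 0 < β := by rw [hβ]; positivity
  have hβκ : β * κ ^ 2 = r * (2 * α) * τ := by rw [hβ]; field_simp
  have hweight : ∀ i ≤ k, r * (τ + α) * τ < β * weight α i := by
    intro i hi
    have hi' : (i : ℝ) * α ≤ k * α :=
      mul_le_mul_of_nonneg_right (by exact_mod_cast hi) hα0.le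
    have hi0 : 0 ≤ (i : ℝ) * α := by positivity
    have h1 : κ ≤ Real.cos (i * α / 2) := by
      rw [hκ]
      exact Real.cos_le_cos_of_nonneg_of_le_pi (by linarith) (by linarith) (by linarith)
    have h2 : κ ≤ Real.cos ((i + 1) * α / 2) := by
      rw [hκ]
      exact Real.cos_le_cos_of_nonneg_of_le_pi (by linarith) (by linarith) (by linarith)
    calc r * (τ + α) * τ < r * (2 * α) * τ := by gcongr; linarith
      _ = β * (κ * κ) := by rw [← hβκ]; ring
      _ ≤ β * weight α i := by
          rw [weight]
          exact mul_le_mul_of_nonneg_left (mul_le_mul h1 h2 hκ0.le (hκ0.le.trans h1)) hβ0.le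
  have hNpos : 0 < N := by exact_mod_cast hN0
  have hmove := movable_tangentArcs (ι := Fin N) (J := fun j => Icc (j * τ) (j * τ + τ))
    hr hw₀ hE (fun θ => by rw [hτ]; exact exists_arc_mem hNpos θ) hτ0.le (fun j => rfl) hα0
    (k := k) (by linarith) (by rw [hkα]; convert hδρ using 3; ring) hweight k 0 (zero_add k) x 1
    (Or.inl rfl)
  -- At the root only arcs with a tangent parallel to `x` are exempt, and their ribbons are thin
  -- too. The precision `1` is arbitrary.
  have hroot := Movable.exempt_less_of_near (C := ∅) hr.le hτ0.le (fun j => rfl)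
    (hweight 0 (Nat.zero_le k)) ?_ hmove c hc0 1 one_pos
  · obtain ⟨ψ', A, h1, -, h3⟩ := hroot 0 0
    rw [zero_add, ← hx] at h1
    refine ⟨(⋃ j, A j) ∪ Metric.sphere z r, ?_,
      (h1.mono (placements_mono E subset_union_left)).trans
        (joinedIn_rotate z ψ' ψ fun s w hw => Or.inr (hsph z s w hw))⟩
    have hw1 : weight α 0 ≤ 1 := by
      have : weight α 0 = Real.cos (α / 2) := by simp [weight]
      rw [this]; exact Real.cos_le_one _
    calc volume ((⋃ j, A j) ∪ Metric.sphere z r)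
        ≤ volume (⋃ j, A j) + volume (Metric.sphere z r) := measure_union_le _ _
      _ = volume (⋃ j, A j) := by rw [hnull, add_zero]
      _ ≤ ∑ j, volume (A j) := measure_iUnion_fintype_le _ _
      _ ≤ ∑ _j : Fin N, ENNReal.ofReal (β * c) := by
          refine Finset.sum_le_sum fun j _ => ((h3 j).resolve_left (notMem_empty j)).trans ?_
          exact ENNReal.ofReal_le_ofReal (mul_le_mul_of_nonneg_right
            (mul_le_of_le_one_right hβ0.le hw1) hc0.le)
      _ = ENNReal.ofReal (N * (β * c)) := by
          rw [Finset.sum_const, Finset.card_univ, Fintype.card_fin, nsmul_eq_mul,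
            ENNReal.ofReal_mul hN0.le, ENNReal.ofReal_natCast]
      _ < ENNReal.ofReal ε := by
          rw [ENNReal.ofReal_lt_ofReal_iff hε, ← mul_lt_mul_iff_left₀ (by positivity : 0 < κ ^ 2)]
          calc N * (β * c) * κ ^ 2 = N * τ * (r * (2 * α)) * c := by
                linear_combination N * c * hβκ
            _ = α * (4 * Real.pi * r * c) := by rw [hNτ]; ring
            _ < ε * κ ^ 2 := by linarith
  · rintro j ⟨θ, hθ, ρ', hρ', h0⟩ -
    have : ρ' = 0 := le_antisymm (by simpa using hρ'.2) hρ'.1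
    exact ⟨θ, hθ, 0, by simpa using hα0.le, by simpa [this] using h0⟩

/-! ### Transfer from `ℂ` to the plane -/

/-- The standard identification of `ℂ` with the plane. -/
noncomputable def complexPlane : ℂ ≃ₗᵢ[ℝ] Plane := Complex.orthonormalBasisOneI.repr

/-- The rotation by `q.2` about `o` followed by the translation by `q.1`. -/
noncomputable def motion (o : Plane) (q : ℂ × ℝ) : Plane ≃ᵃⁱ[ℝ] Plane :=
  AffineIsometryEquiv.mk'
    (fun x => complexPlane (q.1 + dir q.2 * complexPlane.symm (x - o)) + o)
    (complexPlane.symm.trans ((rotation (Circle.exp q.2)).trans complexPlane)) o fun x => by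
      simp [rotation_apply, dir, add_assoc, add_comm (complexPlane q.1)]

lemma motion_apply (o : Plane) (q : ℂ × ℝ) (x : Plane) :
    motion o q x = complexPlane (q.1 + dir q.2 * complexPlane.symm (x - o)) + o := rfl

lemma det_conj_complexPlane (f : ℂ ≃ₗᵢ[ℝ] ℂ) :
    LinearMap.det ((complexPlane.symm.trans (f.trans complexPlane)).toLinearEquiv :
      Plane →ₗ[ℝ] Plane) = LinearMap.det (f.toLinearEquiv : ℂ →ₗ[ℝ] ℂ) := by
  rw [← LinearMap.det_conj (f.toLinearEquiv : ℂ →ₗ[ℝ] ℂ) complexPlane.toLinearEquiv]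
  rfl

lemma isRigidMotion_motion (o : Plane) (q : ℂ × ℝ) : IsRigidMotion (motion o q) := by
  rw [IsRigidMotion, motion, AffineIsometryEquiv.linearIsometryEquiv_mk', det_conj_complexPlane,
    det_rotation]
  exact one_pos

lemma motion_zero (o : Plane) : motion o (0, 0) = AffineIsometryEquiv.refl ℝ Plane := by
  ext1 x
  simp [motion_apply, dir_zero]

lemma continuous_motion_comp {X : Type*} [TopologicalSpace X] (o : Plane) {f : X → ℂ × ℝ}
    {h : X → Plane} (hf : Continuous f) (hh : Continuous h) :
    Continuous fun y => motion o (f y) (h y) := by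
  simp only [motion_apply]
  have := continuous_dir
  fun_prop

/-- A linear isometry of `ℂ` is a rotation, possibly after conjugation; the sign of the determinant
rules out the latter. -/
lemma IsRigidMotion.exists_eq_motion {g : Plane ≃ᵃⁱ[ℝ] Plane} (hg : IsRigidMotion g) (o : Plane) :
    ∃ q, g = motion o q := by
  obtain ⟨f, hf⟩ : ∃ f : ℂ ≃ₗᵢ[ℝ] ℂ,
      g.linearIsometryEquiv = complexPlane.symm.trans (f.trans complexPlane) :=
    ⟨complexPlane.trans (g.linearIsometryEquiv.trans complexPlane.symm), by ext1 x; simp⟩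
  rw [IsRigidMotion, hf, det_conj_complexPlane] at hg
  obtain ⟨a, ha | ha⟩ := linear_isometry_complex f
  · refine ⟨(complexPlane.symm (g o - o), Complex.arg a), ?_⟩
    ext1 x
    have hx : g x = g.linearIsometryEquiv (x - o) + g o := by
      have := g.map_vadd o (x - o)
      simpa using this
    have hdir : dir (Complex.arg a) = a := by
      have := congrArg Subtype.val (Circle.exp_arg a)
      rwa [Circle.coe_exp] at this
    rw [hx, hf, ha, motion_apply, hdir, map_add]
    simp only [LinearIsometryEquiv.trans_apply, rotation_apply,
      LinearIsometryEquiv.apply_symm_apply]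
    abel
  · exfalso
    have : LinearMap.det (f.toLinearEquiv : ℂ →ₗ[ℝ] ℂ) = -1 := by
      have e : (f.toLinearEquiv : ℂ →ₗ[ℝ] ℂ) =
          ((rotation a).toLinearEquiv : ℂ →ₗ[ℝ] ℂ).comp
            (Complex.conjLIE.toLinearEquiv : ℂ →ₗ[ℝ] ℂ) := by rw [ha]; rfl
      rw [e, LinearMap.det_comp, det_rotation, Complex.det_conjLIE, one_mul]
    linarith

lemma volume_preimage_complexPlane (o : Plane) (A : Set ℂ) :
    volume ((fun x : Plane => complexPlane.symm (x - o)) ⁻¹' A) = volume A := by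
  have h := (complexPlane.symm.measurePreserving).measure_preimage_emb
    complexPlane.symm.toHomeomorph.measurableEmbedding A
  rw [← h, ← measure_preimage_add_right volume o]
  simp only [preimage_preimage, add_sub_cancel_right]

theorem strongKakeyaProperty_of_subset_sphere (o v : Plane) {r ρ : ℝ} (hr : 0 < r) (hρ : 0 < ρ)
    (hv : ‖v‖ = r) (E : Set Plane)
    (hE : ∀ x ∈ E, ‖x - o‖ = r ∧ ρ ≤ ‖x - o - v‖ ∧ ρ ≤ ‖x - o + v‖) :
    StrongKakeyaProperty E := by
  intro g hg ε hε
  obtain ⟨⟨z, ψ⟩, rfl⟩ := hg.exists_eq_motion o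
  obtain ⟨A, hA, P, hP⟩ := exists_joinedIn_placements
    (E := (fun x : Plane => complexPlane.symm (x - o)) '' E) (w₀ := complexPlane.symm v) hr hρ
    (by rw [LinearIsometryEquiv.norm_map, hv])
    (by
      rintro _ ⟨x, hx, rfl⟩
      simp only [← map_sub complexPlane.symm, ← map_add complexPlane.symm,
        LinearIsometryEquiv.norm_map]
      exact hE x hx) z ψ hε
  refine ⟨fun t => motion o (P t), ⟨fun t => isRigidMotion_motion o _, ?_⟩,
    (congrArg (motion o) P.source).trans (motion_zero o), congrArg (motion o) P.target, ?_⟩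
  · exact continuous_motion_comp o (P.continuous.comp continuous_fst) continuous_snd
  · refine lt_of_le_of_lt (measure_mono ?_) ((volume_preimage_complexPlane o A).trans_lt hA)
    refine iUnion_subset fun t => ?_
    rintro _ ⟨x, hx, rfl⟩
    have := hP t _ ⟨x, hx, rfl⟩
    rwa [mem_preimage, motion_apply, add_sub_cancel_right, LinearIsometryEquiv.symm_apply_apply]

end KakeyaNeedle

theorem mainTheorem7 (S : EuclideanGeometry.Sphere KakeyaNeedle.Plane) (hS : 0 < S.radius)
    (p q : KakeyaNeedle.Plane) (hpq : S.IsDiameter p q)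
    (U : Set KakeyaNeedle.Plane) (hU : U ∈ 𝓝ˢ ({p, q} : Set KakeyaNeedle.Plane)) :
    KakeyaNeedle.StrongKakeyaProperty ((S : Set KakeyaNeedle.Plane) \ U) := by
  rw [mem_nhdsSet_iff_forall] at hU
  obtain ⟨ρ₁, hρ₁, h₁⟩ := Metric.mem_nhds_iff.1 (hU p (by simp))
  obtain ⟨ρ₂, hρ₂, h₂⟩ := Metric.mem_nhds_iff.1 (hU q (by simp))
  have hq : q = S.center - (p - S.center) := by
    rw [← hpq.pointReflection_center_left, Equiv.pointReflection_apply, vsub_eq_sub, vadd_eq_add]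
    abel
  refine KakeyaNeedle.strongKakeyaProperty_of_subset_sphere S.center (p - S.center) hS
    (lt_min hρ₁ hρ₂) ?_ _ ?_
  · rw [← dist_eq_norm]; exact EuclideanGeometry.mem_sphere.1 hpq.left_mem
  · rintro x ⟨hx, hxU⟩
    refine ⟨?_, ?_, ?_⟩
    · rw [← dist_eq_norm]; exact EuclideanGeometry.mem_sphere.1 hx
    · refine (min_le_left _ _).trans (not_lt.1 fun h => hxU (h₁ ?_))
      rw [sub_sub_sub_cancel_right] at h
      rwa [Metric.mem_ball, dist_eq_norm]
    · refine (min_le_right _ _).trans (not_lt.1 fun h => hxU (h₂ ?_))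
      have e : x - q = x - S.center + (p - S.center) := by rw [hq]; abel
      rwa [Metric.mem_ball, dist_eq_norm, e]
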